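/- Let $k\ge 2$ and $d\ge 1$ be integers, and let $F(z)=\sum_{i\ge 0} f(i)z^i\in\mathbb{C}[[z]]$ be a $k$-Mahler function satisfying $$a_0(z)F(z)+a_1(z)F(z^k)+\cdots+a_d(z)F(z^{k^d})=0$$ for polynomials $a_0(z),\ldots,a_d(z)\in\mathbb{C}[z]$ with $a_d(z)\neq 0$. Set $H:=\max\{\deg a_i(z): 0\le i\le d,\ a_i\ne 0\}$ and $$\kappa:=\left\lfloor \frac{H(k-1)}{k^{d+1}-2k^d+1}\right\rfloor+\left\lfloor \frac{H}{k^{d-1}(k-1)}\right\rfloor+1 .$$ Let $\mathbf{M}$ be the $$(1+\kappa)\times\left(1+H+\kappa\,\frac{k^{d+1}-1}{k-1}\right)$$ matrix whose $(i,j)$-entry is $f(i+j-2)$ (rows and columns numbered from $1$). Then: 1. $F(z)$ is a rational function (an element of $\mathbb{C}(z)$) if and only if $\mathbf{M}$ does not have full rank, i.e. $\operatorname{rank}\mathbf{M}\neq 1+\kappa$; 2. $F(z)$ is transcendental over $\mathbb{C}(z)$ if and only if $\mathbf{M}$ has full rank, i.e. $\operatorname{rank}\mathbf{M}=1+\kappa$.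 -/

import Mathlib

open scoped Polynomial PowerSeries LaurentSeries RatFunc

noncomputable section

/-- The power series `F(z^n)` obtained from `F(z)`, for `n ≥ 1`. -/
def substPow (n : ℕ) (F : ℂ⟦X⟧) : ℂ⟦X⟧ :=
  PowerSeries.subst (PowerSeries.X ^ n : ℂ⟦X⟧) F

/-- `F(z)` satisfies the Mahler equation `a₀(z) F(z) + a₁(z) F(z^k) + ⋯ + a_d(z) F(z^(k^d)) = 0`. -/
def SatisfiesMahlerEquation (k d : ℕ) (a : Fin (d + 1) → ℂ[X]) (F : ℂ⟦X⟧) : Prop :=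
  ∑ i : Fin (d + 1), (a i : ℂ⟦X⟧) * substPow (k ^ (i : ℕ)) F = 0

/-- `H = max {deg a_i : 0 ≤ i ≤ d}`. -/
def mahlerHeight {d : ℕ} (a : Fin (d + 1) → ℂ[X]) : ℕ :=
  Finset.univ.sup fun i => (a i).natDegree

/-- `κ = ⌊H (k-1) / (k^(d+1) - 2 k^d + 1)⌋ + ⌊H / (k^(d-1) (k-1))⌋ + 1`, for `k ≥ 2` and `d ≥ 1`
(then no subtraction truncates; `/` on `ℕ` is the floor of the quotient). -/
def mahlerKappa (k d H : ℕ) : ℕ :=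
  H * (k - 1) / (k ^ (d + 1) - 2 * k ^ d + 1) + H / (k ^ (d - 1) * (k - 1)) + 1

/-- The number of columns `1 + H + κ (k^(d+1) - 1) / (k - 1)`, for `k ≥ 2`
(`k - 1` divides `k^(d+1) - 1`). -/
def mahlerColumns (k d H : ℕ) : ℕ :=
  1 + H + mahlerKappa k d H * ((k ^ (d + 1) - 1) / (k - 1))

/-- The Hankel matrix with `1 + κ` rows whose entries, with rows and columns numbered from `0`,
are the coefficients `f(i + j)` of `F` (that is `f(i + j - 2)` when numbering from `1`). -/
def mahlerHankel (k d H : ℕ) (F : ℂ⟦X⟧) :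
    Matrix (Fin (1 + mahlerKappa k d H)) (Fin (mahlerColumns k d H)) ℂ :=
  Matrix.of fun i j => PowerSeries.coeff ((i : ℕ) + (j : ℕ)) F

/-- `F` is (the expansion at `0` of) a rational function in `ℂ(z)`. -/
def IsRationalSeries (F : ℂ⟦X⟧) : Prop :=
  ∃ r : RatFunc ℂ, algebraMap (RatFunc ℂ) ℂ⸨X⸩ r = (F : ℂ⸨X⸩)

/-- `F` is transcendental over `ℂ(z)`. -/
def IsTranscendentalSeries (F : ℂ⟦X⟧) : Prop :=
  Transcendental (RatFunc ℂ) (F : ℂ⸨X⸩)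

end

/-!
Write `K = ℂ(z)` and `F_i(z) = F(z ^ (k ^ i))`, so that `a₀ F_0 + ⋯ + a_d F_d = 0`.

*Rational solutions and the Hankel matrix.* Let `F = P / Q` in lowest terms. Clearing denominators
in the Mahler equation shows that `Q(z ^ (k ^ d))` divides `a_d ∏_{j < d} Q(z ^ (k ^ j))`, which
bounds `deg Q` (`natDegree_denom_le`), and comparing degrees bounds `deg P - deg Q`
(`natDegree_num_sub_le`). Together `deg P` and `deg Q` are less than `κ`, and the coefficients of
`Q` form a row vector killing the Hankel matrix. Conversely, such a row vector gives a nonzero `Q`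
of degree at most `κ` such that `Q F` agrees with a polynomial `P` to high order. The cleared Mahler
sum of `P / Q` is then a polynomial with more zeros at `0` than its degree allows, so `P / Q` solves
the equation as well, and so does the difference `F - P / Q`. A solution whose order at `0` exceeds
the height vanishes (`eq_zero_of_clearedMahlerSeries_eq_zero`), hence `F = P / Q`.

*Algebraic solutions are rational.* Suppose that `F` is algebraic over `K`. Since `a_d ≠ 0`, all
`F_i` lie in the finite extension `L = K(F_0, …, F_{d-1})`. After passing to an equation with
nonzero lowest coefficient (`exists_mahlerEquation_zero_ne_zero`), `F` lies in the `K`-span of the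
`F_i` with `i ≥ n`, for every `n`; these are invariant under `z ↦ ζ z` whenever `ζ ^ (k ^ n) = 1`.
Consequently `L` contains the rotations `F(ζ z)` for all these `ζ`. Let `y = D F` be a multiple
that is integral over `ℂ[z]`. For `j < k ^ n` the part `u` of `y` supported on the exponents
congruent to `j` modulo `k ^ n` is an average of rotations of `y`, so it is integral over `ℂ[z]`,
of degree at most `[L : K]` over `K`, and its pole at infinity is bounded independently of `j` and
`n`. Therefore the constant coefficient of its minimal polynomial is a polynomial of degree
bounded by a constant. But `u`, and hence `z ^ j`, divides this polynomial, so `u = 0` and the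
`j`-th coefficient of `y` vanishes for large `j` (`exists_coe_eq_of_isIntegral_of_rescale_mem`).
So `y` is a polynomial and `F` is rational (`isRationalSeries_of_isAlgebraic`).
-/

/-! ### The substitution `z ↦ z ^ n` -/

theorem substPow_eq_expand {n : ℕ} (hn : n ≠ 0) (F : ℂ⟦X⟧) :
    substPow n F = PowerSeries.expand n hn F :=
  (PowerSeries.expand_apply n hn F).symm

theorem coe_expand {n : ℕ} (hn : n ≠ 0) (p : ℂ[X]) :
    ((Polynomial.expand ℂ n p : ℂ[X]) : ℂ⟦X⟧) = PowerSeries.expand n hn (p : ℂ⟦X⟧) := by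
  ext m
  rw [Polynomial.coeff_coe, Polynomial.coeff_expand (Nat.pos_of_ne_zero hn),
    PowerSeries.coeff_expand, Polynomial.coeff_coe]

section Cleared

variable {k d : ℕ} (hk : k ≠ 0) (a : Fin (d + 1) → ℂ[X])

/-- The left-hand side of the Mahler equation evaluated at `P / Q` and multiplied by the common
denominator `∏ⱼ Q(z ^ (k ^ j))`. -/
noncomputable def clearedMahlerSum (k : ℕ) (a : Fin (d + 1) → ℂ[X]) (P Q : ℂ[X]) : ℂ[X] :=
  ∑ i : Fin (d + 1), a i * Polynomial.expand ℂ (k ^ (i : ℕ)) P *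
    ∏ j ∈ Finset.univ.erase i, Polynomial.expand ℂ (k ^ (j : ℕ)) Q

/-- The analogue of `clearedMahlerSum` for a power series numerator and denominator. -/
noncomputable def clearedMahlerSeries (a : Fin (d + 1) → ℂ[X]) (E Q : ℂ⟦X⟧) : ℂ⟦X⟧ :=
  ∑ i : Fin (d + 1), (a i : ℂ⟦X⟧) * PowerSeries.expand (k ^ (i : ℕ)) (pow_ne_zero _ hk) E *
    ∏ j ∈ Finset.univ.erase i, PowerSeries.expand (k ^ (j : ℕ)) (pow_ne_zero _ hk) Q

theorem coe_clearedMahlerSum (P Q : ℂ[X]) :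
    (clearedMahlerSum k a P Q : ℂ⟦X⟧) = clearedMahlerSeries hk a P Q := by
  have h : ∀ p : ℂ[X], (p : ℂ⟦X⟧) = Polynomial.coeToPowerSeries.ringHom p := fun _ => rfl
  simp only [clearedMahlerSum, clearedMahlerSeries, h, map_sum, map_mul, map_prod]
  simp only [← h, coe_expand (pow_ne_zero _ hk)]

theorem clearedMahlerSeries_sub (E E' Q : ℂ⟦X⟧) :
    clearedMahlerSeries hk a (E - E') Q =
      clearedMahlerSeries hk a E Q - clearedMahlerSeries hk a E' Q := by
  simp only [clearedMahlerSeries, map_sub, mul_sub, sub_mul, Finset.sum_sub_distrib]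

theorem clearedMahlerSeries_mul_eq_zero {F : ℂ⟦X⟧} (hF : SatisfiesMahlerEquation k d a F)
    (Q : ℂ⟦X⟧) : clearedMahlerSeries hk a (Q * F) Q = 0 := by
  have h : clearedMahlerSeries hk a (Q * F) Q =
      (∑ i : Fin (d + 1), (a i : ℂ⟦X⟧) * substPow (k ^ (i : ℕ)) F) *
        ∏ j : Fin (d + 1), PowerSeries.expand (k ^ (j : ℕ)) (pow_ne_zero _ hk) Q := by
    rw [clearedMahlerSeries, Finset.sum_mul]
    refine Finset.sum_congr rfl fun i _ => ?_
    rw [← Finset.mul_prod_erase _ _ (Finset.mem_univ i), map_mul,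
      substPow_eq_expand (pow_ne_zero _ hk)]
    ring
  rw [h, hF, zero_mul]

theorem natDegree_le_mahlerHeight (i : Fin (d + 1)) : (a i).natDegree ≤ mahlerHeight a :=
  Finset.le_sup (f := fun i => (a i).natDegree) (Finset.mem_univ i)

theorem natDegree_prod_expand_le (s : Finset (Fin (d + 1))) (Q : ℂ[X]) :
    (∏ j ∈ s, Polynomial.expand ℂ (k ^ (j : ℕ)) Q).natDegree ≤
      (∑ j ∈ s, k ^ (j : ℕ)) * Q.natDegree := by
  refine (Polynomial.natDegree_prod_le _ _).trans ?_
  rw [Finset.sum_mul]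
  refine Finset.sum_le_sum fun j _ => ?_
  rw [Polynomial.natDegree_expand, mul_comm]

theorem sum_erase_last_pow :
    ∑ j ∈ Finset.univ.erase (Fin.last d), k ^ (j : ℕ) = ∑ j ∈ Finset.range d, k ^ j := by
  have h := Finset.add_sum_erase Finset.univ (fun j : Fin (d + 1) => k ^ (j : ℕ))
    (Finset.mem_univ (Fin.last d))
  rw [Fin.sum_univ_eq_sum_range (fun j => k ^ j), Finset.sum_range_succ, Fin.val_last] at h
  omega

theorem geom_sum_mul_pred (hk1 : 1 ≤ k) (n : ℕ) :
    (∑ j ∈ Finset.range n, k ^ j) * (k - 1) + 1 = k ^ n := by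
  obtain ⟨t, rfl⟩ := Nat.exists_eq_add_of_le' hk1
  simpa using geom_sum_mul_add t n

/-! ### Degrees of rational solutions -/

/-- The denominator `Q` of a rational solution: `Q(z ^ (k ^ d))` is prime to `P(z ^ (k ^ d))` and
therefore divides `a_d ∏_{j < d} Q(z ^ (k ^ j))`. -/
theorem natDegree_denom_le (hk2 : 2 ≤ k) (ha : a (Fin.last d) ≠ 0) {P Q : ℂ[X]} (hQ : Q ≠ 0)
    (hPQ : IsCoprime P Q) (h : clearedMahlerSum k a P Q = 0) :
    Q.natDegree ≤ mahlerHeight a * (k - 1) / (k ^ (d + 1) - 2 * k ^ d + 1) := by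
  have hkpos : ∀ j : ℕ, 0 < k ^ j := fun j => pow_pos (by omega) j
  have hdvd : Polynomial.expand ℂ (k ^ d) Q ∣ a (Fin.last d) *
      Polynomial.expand ℂ (k ^ d) P *
        ∏ j ∈ Finset.univ.erase (Fin.last d), Polynomial.expand ℂ (k ^ (j : ℕ)) Q := by
    rw [clearedMahlerSum, ← Finset.add_sum_erase _ _ (Finset.mem_univ (Fin.last d))] at h
    rw [Fin.val_last] at h
    rw [eq_neg_of_add_eq_zero_left h, dvd_neg]
    refine Finset.dvd_sum fun i hi => Dvd.dvd.mul_left ?_ _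
    have := Finset.dvd_prod_of_mem (fun j : Fin (d + 1) => Polynomial.expand ℂ (k ^ (j : ℕ)) Q)
      (Finset.mem_erase.2 ⟨(Finset.ne_of_mem_erase hi).symm, Finset.mem_univ (Fin.last d)⟩)
    simpa using this
  have hcop : IsCoprime (Polynomial.expand ℂ (k ^ d) Q) (Polynomial.expand ℂ (k ^ d) P) :=
    hPQ.symm.map (Polynomial.expand ℂ (k ^ d)).toRingHom
  rw [mul_right_comm] at hdvd
  have hdvd' := hcop.dvd_of_dvd_mul_right hdvd
  have hne : a (Fin.last d) *
      ∏ j ∈ Finset.univ.erase (Fin.last d), Polynomial.expand ℂ (k ^ (j : ℕ)) Q ≠ 0 :=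
    mul_ne_zero ha (Finset.prod_ne_zero_iff.2 fun j _ =>
      (Polynomial.expand_ne_zero (hkpos _)).2 hQ)
  have hdeg := (Polynomial.natDegree_le_of_dvd hdvd' hne).trans Polynomial.natDegree_mul_le
  have h1 := natDegree_le_mahlerHeight a (Fin.last d)
  have h2 := natDegree_prod_expand_le (k := k) (Finset.univ.erase (Fin.last d)) Q
  rw [sum_erase_last_pow] at h2
  rw [Polynomial.natDegree_expand] at hdeg
  have h3 := geom_sum_mul_pred (k := k) (by omega) d
  clear hdvd hdvd' hcop hne h hkpos
  rw [Nat.le_div_iff_mul_le (by omega)]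
  obtain ⟨t, rfl⟩ := Nat.exists_eq_add_of_le' hk2
  have h4 : (t + 2) ^ (d + 1) - 2 * (t + 2) ^ d = t * (t + 2) ^ d := by
    rw [pow_succ', ← Nat.sub_mul, Nat.add_sub_cancel]
  rw [h4]
  rw [show t + 2 - 1 = t + 1 from rfl] at h3 ⊢
  have h6 : Q.natDegree * (t + 2) ^ d ≤
      mahlerHeight a + (∑ j ∈ Finset.range d, (t + 2) ^ j) * Q.natDegree := by omega
  generalize (t + 2) ^ d = K at *
  generalize (∑ j ∈ Finset.range d, (t + 2) ^ j) = S at *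
  subst h3
  clear h4 h2 hdeg
  nlinarith [Nat.mul_le_mul_right (t + 1) h6]

/-- The pole order `deg P - deg Q` at infinity of a rational solution: the term
`a_d(z) F(z ^ (k ^ d))` must be cancelled there by the terms of lower index. -/
theorem natDegree_num_sub_le (hk2 : 2 ≤ k) (hd : 1 ≤ d) (ha : a (Fin.last d) ≠ 0) {P Q : ℂ[X]}
    (hP : P ≠ 0) (hQ : Q ≠ 0) (h : clearedMahlerSum k a P Q = 0) :
    P.natDegree - Q.natDegree ≤ mahlerHeight a / (k ^ (d - 1) * (k - 1)) := by
  have hkpos : ∀ j : ℕ, 0 < k ^ j := fun j => pow_pos (by omega) j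
  rw [Nat.le_div_iff_mul_le (Nat.mul_pos (hkpos _) (by omega))]
  obtain hle | hlt := le_or_gt P.natDegree Q.natDegree
  · simp [Nat.sub_eq_zero_of_le hle]
  obtain ⟨e, he⟩ := Nat.exists_eq_add_of_le hlt.le
  rw [clearedMahlerSum, ← Finset.add_sum_erase _ _ (Finset.mem_univ (Fin.last d))] at h
  have h0 := congrArg Polynomial.natDegree (eq_neg_of_add_eq_zero_left h)
  have hQe : ∀ j : ℕ, Polynomial.expand ℂ (k ^ j) Q ≠ 0 := fun j =>
    (Polynomial.expand_ne_zero (hkpos _)).2 hQ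
  have hprod : ∀ i : Fin (d + 1),
      (∏ j ∈ Finset.univ.erase i, Polynomial.expand ℂ (k ^ (j : ℕ)) Q).natDegree +
        k ^ (i : ℕ) * Q.natDegree = (∑ j : Fin (d + 1), k ^ (j : ℕ)) * Q.natDegree := by
    intro i
    rw [Polynomial.natDegree_prod _ _ fun (j : Fin (d + 1)) _ => hQe j,
      ← Finset.sum_erase_add _ _ (Finset.mem_univ i), add_mul, Finset.sum_mul]
    congr 1
    exact Finset.sum_congr rfl fun j _ => by rw [Polynomial.natDegree_expand, mul_comm]
  rw [Polynomial.natDegree_neg, Polynomial.natDegree_mul (mul_ne_zero ha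
      ((Polynomial.expand_ne_zero (hkpos _)).2 hP))
      (Finset.prod_ne_zero_iff.2 fun (j : Fin (d + 1)) _ => hQe j),
    Polynomial.natDegree_mul ha ((Polynomial.expand_ne_zero (hkpos _)).2 hP),
    Polynomial.natDegree_expand] at h0
  have hsum : (∑ i ∈ Finset.univ.erase (Fin.last d), a i *
      Polynomial.expand ℂ (k ^ (i : ℕ)) P *
        ∏ j ∈ Finset.univ.erase i, Polynomial.expand ℂ (k ^ (j : ℕ)) Q).natDegree ≤
      mahlerHeight a + k ^ (d - 1) * e + (∑ j : Fin (d + 1), k ^ (j : ℕ)) * Q.natDegree := by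
    refine Polynomial.natDegree_sum_le_of_forall_le _ _ fun i hi => ?_
    have hid : (i : ℕ) ≤ d - 1 := by
      have : (i : ℕ) ≠ d := fun hh => Finset.ne_of_mem_erase hi (Fin.ext hh)
      omega
    have h1 := natDegree_le_mahlerHeight a i
    have h2 := Nat.mul_le_mul_right e (Nat.pow_le_pow_right (by omega : 0 < k) hid)
    have h3 := hprod i
    have h4 : (a i * Polynomial.expand ℂ (k ^ (i : ℕ)) P).natDegree ≤
        (a i).natDegree + (Q.natDegree + e) * k ^ (i : ℕ) :=
      Polynomial.natDegree_mul_le.trans (by rw [Polynomial.natDegree_expand, he])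
    refine Polynomial.natDegree_mul_le.trans ?_
    nlinarith
  have h3 := hprod (Fin.last d)
  rw [Fin.val_last] at h0 h3
  have hpow : k ^ d = k ^ (d - 1) * (k - 1) + k ^ (d - 1) := by
    obtain ⟨t, rfl⟩ := Nat.exists_eq_add_of_le' hd
    obtain ⟨s, rfl⟩ := Nat.exists_eq_add_of_le' (show 1 ≤ k by omega)
    simp only [Nat.add_sub_cancel]
    ring
  have hee : P.natDegree - Q.natDegree = e := by omega
  rw [hee]
  rw [he] at h0
  rw [← h0] at hsum
  rw [hpow] at hsum h3
  nlinarith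

/-! ### Power series solutions of high order vanish -/

/-- A solution `E / Q` of the Mahler equation whose order at `0` exceeds the height is zero: the
term of lowest index with nonzero coefficient has an order that no other term has. -/
theorem eq_zero_of_clearedMahlerSeries_eq_zero (hk2 : 2 ≤ k) (ha : a (Fin.last d) ≠ 0)
    {E : ℂ⟦X⟧} {Q : ℂ[X]} (hQ : Q ≠ 0) (h : clearedMahlerSeries hk a E Q = 0)
    (hord : (mahlerHeight a + Q.natDegree + 1 : ℕ) ≤ E.order) : E = 0 := by
  classical
  by_contra hE
  obtain ⟨e, he⟩ : ∃ e : ℕ, E.order = e := ⟨_, (PowerSeries.coe_toNat_order hE).symm⟩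
  have hQ' : (Q : ℂ⟦X⟧) ≠ 0 := by simpa using hQ
  obtain ⟨o, ho⟩ : ∃ o : ℕ, (Q : ℂ⟦X⟧).order = o := ⟨_, (PowerSeries.coe_toNat_order hQ').symm⟩
  have hoQ : o ≤ Q.natDegree := by
    have := PowerSeries.order_le (φ := (Q : ℂ⟦X⟧)) Q.natDegree (by simpa using hQ)
    rw [ho] at this
    exact_mod_cast this
  rw [he] at hord
  replace hord : mahlerHeight a + Q.natDegree + 1 ≤ e := by exact_mod_cast hord
  obtain ⟨f, rfl⟩ := Nat.exists_eq_add_of_le (show o ≤ e by omega)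
  set t : Fin (d + 1) → ℂ⟦X⟧ := fun i =>
    (a i : ℂ⟦X⟧) * PowerSeries.expand (k ^ (i : ℕ)) (pow_ne_zero _ hk) E *
    ∏ j ∈ Finset.univ.erase i, PowerSeries.expand (k ^ (j : ℕ)) (pow_ne_zero _ hk) (Q : ℂ⟦X⟧)
    with ht
  have hord_t : ∀ i, (t i).order = (a i : ℂ⟦X⟧).order +
      ((k ^ (i : ℕ) * f + (∑ j : Fin (d + 1), k ^ (j : ℕ)) * o : ℕ) : ℕ∞) := by
    intro i
    simp only [ht, PowerSeries.order_mul, PowerSeries.order_prod, PowerSeries.order_expand, he, ho]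
    rw [add_assoc]
    congr 1
    rw [← Finset.add_sum_erase _ _ (Finset.mem_univ i), add_mul, Finset.sum_mul]
    push_cast
    simp only [nsmul_eq_mul]
    push_cast
    ring
  have hex : (Finset.univ.filter fun i => a i ≠ 0).Nonempty := ⟨Fin.last d, by simpa using ha⟩
  set i₀ := (Finset.univ.filter fun i => a i ≠ 0).min' hex with hi₀
  have hai₀ : a i₀ ≠ 0 := (Finset.mem_filter.1 (Finset.min'_mem _ hex)).2
  have hai₀' : (a i₀ : ℂ⟦X⟧) ≠ 0 := by simpa using hai₀
  have hαH : (a i₀ : ℂ⟦X⟧).order ≤ (mahlerHeight a : ℕ∞) := by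
    refine (PowerSeries.order_le (a i₀).natDegree (by simpa using hai₀)).trans ?_
    exact_mod_cast natDegree_le_mahlerHeight a i₀
  have hlt : ∀ i, i ≠ i₀ → (t i₀).order < (t i).order := by
    intro i hi
    by_cases hai : a i = 0
    · rw [hord_t i₀, hord_t i, hai]
      simp only [Polynomial.coe_zero, PowerSeries.order_zero, top_add]
      exact WithTop.add_lt_top.2 ⟨hαH.trans_lt (WithTop.coe_lt_top _), WithTop.coe_lt_top _⟩
    have hlt' : i₀ < i := lt_of_le_of_ne
      (Finset.min'_le _ _ (by simpa using hai)) (Ne.symm hi)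
    have hpow : k * k ^ (i₀ : ℕ) ≤ k ^ (i : ℕ) := by
      rw [← pow_succ']
      exact Nat.pow_le_pow_right (by omega) hlt'
    have hone : 1 ≤ k ^ (i₀ : ℕ) := Nat.one_le_pow _ _ (by omega)
    rw [hord_t i₀, hord_t i]
    refine lt_of_le_of_lt (add_le_add_left hαH _) (lt_of_lt_of_le ?_ le_add_self)
    norm_cast
    have h1 : mahlerHeight a < k ^ (i₀ : ℕ) * f := by nlinarith
    have h2 : 2 * k ^ (i₀ : ℕ) * f ≤ k ^ (i : ℕ) * f :=
      Nat.mul_le_mul_right _ ((Nat.mul_le_mul_right _ hk2).trans hpow)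
    nlinarith
  have hti₀ : t i₀ ≠ 0 := by
    rw [← PowerSeries.order_finite_iff_ne_zero, hord_t]
    exact WithTop.add_lt_top.2 ⟨hαH.trans_lt (WithTop.coe_lt_top _), WithTop.coe_lt_top _⟩
  have hcoeff := congrArg (PowerSeries.coeff (t i₀).order.toNat) h
  rw [clearedMahlerSeries, map_sum, map_zero, Finset.sum_eq_single i₀] at hcoeff
  · exact PowerSeries.coeff_order hti₀ hcoeff
  · intro i _ hi
    refine PowerSeries.coeff_of_lt_order _ ?_
    rw [PowerSeries.coe_toNat_order hti₀]
    exact hlt i hi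
  · simp

end Cleared

/-! ### Rational power series and the Hankel matrix -/

theorem algebraMap_ratFunc_coe (p : ℂ[X]) :
    algebraMap (RatFunc ℂ) ℂ⸨X⸩ (algebraMap ℂ[X] (RatFunc ℂ) p) = ((p : ℂ⟦X⟧) : ℂ⸨X⸩) :=
  (RatFunc.coe_coe p).symm

theorem isRationalSeries_of_mul_eq {F : ℂ⟦X⟧} {P Q : ℂ[X]} (hQ : Q ≠ 0)
    (h : (Q : ℂ⟦X⟧) * F = P) : IsRationalSeries F := by
  refine ⟨algebraMap ℂ[X] (RatFunc ℂ) P / algebraMap ℂ[X] (RatFunc ℂ) Q, ?_⟩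
  have hQ' : ((Q : ℂ⟦X⟧) : ℂ⸨X⸩) ≠ 0 := by
    rw [Ne, ← PowerSeries.coe_zero, HahnSeries.ofPowerSeries_injective.eq_iff]
    simpa using hQ
  rw [map_div₀]
  rw [algebraMap_ratFunc_coe, algebraMap_ratFunc_coe, div_eq_iff hQ', mul_comm,
    ← PowerSeries.coe_mul, h]

theorem IsRationalSeries.exists_coprime {F : ℂ⟦X⟧} (h : IsRationalSeries F) :
    ∃ P Q : ℂ[X], Q ≠ 0 ∧ IsCoprime P Q ∧ (Q : ℂ⟦X⟧) * F = P := by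
  obtain ⟨r, hr⟩ := h
  refine ⟨r.num, r.denom, r.denom_ne_zero, r.isCoprime_num_denom, ?_⟩
  apply HahnSeries.ofPowerSeries_injective (Γ := ℤ)
  have hd : algebraMap ℂ[X] (RatFunc ℂ) r.denom ≠ 0 := by
    simpa using r.denom_ne_zero
  rw [PowerSeries.coe_mul, ← hr, ← algebraMap_ratFunc_coe, ← algebraMap_ratFunc_coe, ← map_mul]
  congr 1
  rw [mul_comm, ← eq_div_iff hd, RatFunc.num_div_denom]

theorem rank_ne_card_rows_iff {m n K : Type*} [Fintype m] [Fintype n] [Field K]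
    (M : Matrix m n K) : M.rank ≠ Fintype.card m ↔ ∃ v : m → K, v ≠ 0 ∧ Matrix.vecMul v M = 0 := by
  have h : M.rank = Fintype.card m ↔ Function.Injective M.vecMul := by
    rw [Matrix.vecMul_injective_iff, linearIndependent_iff_card_eq_finrank_span, eq_comm,
      Matrix.rank_eq_finrank_span_row]
    rfl
  rw [Ne, h]
  change ¬ Function.Injective (Matrix.vecMulLinear M) ↔ _
  rw [← LinearMap.ker_eq_bot, Submodule.eq_bot_iff]
  push Not
  simp [and_comm]

theorem coeff_mul_of_natDegree_le {Q : ℂ[X]} {n : ℕ} (hQ : Q.natDegree ≤ n) (F : ℂ⟦X⟧) (j : ℕ) :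
    PowerSeries.coeff (n + j) ((Q : ℂ⟦X⟧) * F) =
      ∑ i : Fin (1 + n), Q.coeff (n - i) * PowerSeries.coeff ((i : ℕ) + j) F := by
  rw [Fin.sum_univ_eq_sum_range (fun i => Q.coeff (n - i) * PowerSeries.coeff (i + j) F) (1 + n),
    add_comm 1 n,
    ← Finset.sum_range_reflect, PowerSeries.coeff_mul,
    Finset.Nat.sum_antidiagonal_eq_sum_range_succ_mk]
  symm
  refine Finset.sum_subset_zero_on_sdiff (Finset.range_mono (by omega)) ?_ ?_
  · intro l hl
    have hl' : n < l := by simpa using (Finset.mem_sdiff.1 hl).2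
    simp [Polynomial.coeff_eq_zero_of_natDegree_lt (hQ.trans_lt hl')]
  · intro l hl
    have hl' : l < n + 1 := Finset.mem_range.1 hl
    rw [Polynomial.coeff_coe, show n - (n + 1 - 1 - l) = l by omega,
      show n + 1 - 1 - l + j = n + j - l by omega]

theorem natDegree_clearedMahlerSum_le {k d : ℕ} (a : Fin (d + 1) → ℂ[X]) {P Q : ℂ[X]} {n : ℕ}
    (hP : P.natDegree ≤ n) (hQ : Q.natDegree ≤ n) :
    (clearedMahlerSum k a P Q).natDegree ≤
      mahlerHeight a + n * ∑ j ∈ Finset.range (d + 1), k ^ j := by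
  rw [← Fin.sum_univ_eq_sum_range (fun j => k ^ j)]
  refine Polynomial.natDegree_sum_le_of_forall_le _ _ fun i _ => ?_
  have h1 := natDegree_le_mahlerHeight a i
  have h2 : (a i * Polynomial.expand ℂ (k ^ (i : ℕ)) P).natDegree ≤
      (a i).natDegree + n * k ^ (i : ℕ) :=
    Polynomial.natDegree_mul_le.trans (by
      rw [Polynomial.natDegree_expand]; gcongr)
  have h3 := natDegree_prod_expand_le (k := k) (Finset.univ.erase i) Q
  have h4 := Nat.mul_le_mul_left (∑ j ∈ Finset.univ.erase i, k ^ (j : ℕ)) hQ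
  rw [← Finset.add_sum_erase _ _ (Finset.mem_univ i)]
  refine Polynomial.natDegree_mul_le.trans ?_
  nlinarith

theorem mahlerColumns_eq {k : ℕ} (hk : 2 ≤ k) (d H : ℕ) :
    mahlerColumns k d H = 1 + H + mahlerKappa k d H * ∑ j ∈ Finset.range (d + 1), k ^ j := by
  rw [mahlerColumns, Nat.geomSum_eq hk]

theorem X_pow_dvd_clearedMahlerSeries {k d : ℕ} (hk : k ≠ 0) (a : Fin (d + 1) → ℂ[X])
    {E : ℂ⟦X⟧} (Q : ℂ⟦X⟧) {N : ℕ} (hE : PowerSeries.X ^ N ∣ E) :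
    PowerSeries.X ^ N ∣ clearedMahlerSeries hk a E Q := by
  refine Finset.dvd_sum fun i _ => Dvd.dvd.mul_right (Dvd.dvd.mul_left ?_ _) _
  have h := map_dvd (PowerSeries.expand (k ^ (i : ℕ)) (pow_ne_zero _ hk)) hE
  rw [map_pow, PowerSeries.expand_X, ← pow_mul] at h
  exact (pow_dvd_pow _ (Nat.le_mul_of_pos_left _ (by positivity))).trans h

theorem rank_mahlerHankel_ne_of_isRationalSeries {k d : ℕ} (hk : 2 ≤ k) (hd : 1 ≤ d)
    (a : Fin (d + 1) → ℂ[X]) (ha : a (Fin.last d) ≠ 0)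
    {F : ℂ⟦X⟧} (hF : SatisfiesMahlerEquation k d a F) (hrat : IsRationalSeries F) :
    (mahlerHankel k d (mahlerHeight a) F).rank ≠ 1 + mahlerKappa k d (mahlerHeight a) := by
  obtain ⟨P, Q, hQ, hPQ, hQF⟩ := hrat.exists_coprime
  have hk0 : k ≠ 0 := by omega
  have hcl : clearedMahlerSum k a P Q = 0 := by
    rw [← Polynomial.coe_eq_zero_iff, coe_clearedMahlerSum hk0, ← hQF]
    exact clearedMahlerSeries_mul_eq_zero hk0 a hF _
  set n := mahlerKappa k d (mahlerHeight a) with hn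
  have hQn : Q.natDegree < n := by
    have := natDegree_denom_le a hk ha hQ hPQ hcl
    rw [hn, mahlerKappa]
    exact Nat.lt_succ_of_le (this.trans (Nat.le_add_right _ _))
  have hPn : P.natDegree < n := by
    obtain rfl | hP := eq_or_ne P 0
    · simpa using (Nat.zero_le _).trans_lt hQn
    have h1 := natDegree_denom_le a hk ha hQ hPQ hcl
    have h2 := natDegree_num_sub_le a hk hd ha hP hQ hcl
    rw [hn, mahlerKappa]
    omega
  have key := (rank_ne_card_rows_iff (mahlerHankel k d (mahlerHeight a) F)).2
    ⟨fun i => Q.coeff (n - i), ?_, ?_⟩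
  · simpa using key
  · intro h0
    have := congrFun h0 ⟨n - Q.natDegree, by omega⟩
    simp only [Pi.zero_apply, show n - (n - Q.natDegree) = Q.natDegree by omega] at this
    exact hQ (by simpa using this)
  · ext j
    have h := coeff_mul_of_natDegree_le hQn.le F j
    rw [hQF, Polynomial.coeff_coe, Polynomial.coeff_eq_zero_of_natDegree_lt (by omega)] at h
    exact h.symm

/-- A kernel row of the Hankel matrix gives `Q` of degree at most `κ` such that `Q F` agrees with a
polynomial `P` of degree less than `κ` to high order. The cleared Mahler sum of `P / Q` is a
polynomial whose order at `0` exceeds its degree bound, so it vanishes, and so does `Q F - P`. -/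
theorem isRationalSeries_of_rank_mahlerHankel_ne {k d : ℕ} (hk : 2 ≤ k)
    (a : Fin (d + 1) → ℂ[X]) (ha : a (Fin.last d) ≠ 0)
    {F : ℂ⟦X⟧} (hF : SatisfiesMahlerEquation k d a F)
    (hrank : (mahlerHankel k d (mahlerHeight a) F).rank ≠ 1 + mahlerKappa k d (mahlerHeight a)) :
    IsRationalSeries F := by
  have hk0 : k ≠ 0 := by omega
  have hcol := mahlerColumns_eq hk d (mahlerHeight a)
  set n := mahlerKappa k d (mahlerHeight a) with hn
  set N := mahlerColumns k d (mahlerHeight a) with hN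
  have hrank' : (mahlerHankel k d (mahlerHeight a) F).rank ≠ Fintype.card (Fin (1 + n)) := by
    simpa using hrank
  obtain ⟨v, hv, hvM⟩ := (rank_ne_card_rows_iff _).1 hrank'
  -- row `i` of the Hankel matrix pairs with the coefficient of `z ^ (κ - i)`, hence the reversal
  set Q : ℂ[X] := Polynomial.ofFn (1 + n) fun i => v i.rev with hQdef
  have hQcoeff : ∀ i : Fin (1 + n), Q.coeff (n - i) = v i := by
    intro i
    have hi := i.2
    rw [hQdef, Polynomial.ofFn_coeff_eq_val_of_lt _ (show n - (i : ℕ) < 1 + n by omega)]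
    congr 1
    ext
    simp only [Fin.val_rev]
    omega
  have hQ : Q ≠ 0 := by
    intro h0
    apply hv
    ext i
    rw [← hQcoeff i, h0]
    simp
  have hQn : Q.natDegree ≤ n :=
    Nat.lt_succ_iff.1 (by
      rw [Nat.succ_eq_one_add]
      exact Polynomial.ofFn_natDegree_lt (by omega) _)
  set P : ℂ[X] := PowerSeries.trunc n ((Q : ℂ⟦X⟧) * F) with hPdef
  have hPn : P.natDegree ≤ n := by
    refine Polynomial.natDegree_le_iff_degree_le.2 ?_
    exact (PowerSeries.degree_trunc_lt _ _).le
  have hE : PowerSeries.X ^ (n + N) ∣ (Q : ℂ⟦X⟧) * F - (P : ℂ⟦X⟧) := by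
    rw [PowerSeries.X_pow_dvd_iff]
    intro m hm
    rw [map_sub, Polynomial.coeff_coe, hPdef, PowerSeries.coeff_trunc]
    split_ifs with hmn
    · exact sub_self _
    obtain ⟨j, rfl⟩ := Nat.exists_eq_add_of_le (not_lt.1 hmn)
    rw [sub_zero, coeff_mul_of_natDegree_le hQn]
    simp only [hQcoeff]
    exact congrFun hvM ⟨j, by omega⟩
  have hsub : clearedMahlerSeries hk0 a ((Q : ℂ⟦X⟧) * F - (P : ℂ⟦X⟧)) Q =
      -(clearedMahlerSum k a P Q) := by
    rw [clearedMahlerSeries_sub, clearedMahlerSeries_mul_eq_zero hk0 a hF, coe_clearedMahlerSum hk0,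
      zero_sub]
  have hzero : clearedMahlerSum k a P Q = 0 := by
    have h1 := X_pow_dvd_clearedMahlerSeries hk0 a (Q : ℂ⟦X⟧) hE
    rw [hsub, dvd_neg, PowerSeries.X_pow_dvd_iff] at h1
    have h2 := natDegree_clearedMahlerSum_le (k := k) a hPn hQn
    ext m
    rw [Polynomial.coeff_zero]
    obtain hm | hm := lt_or_ge m (n + N)
    · simpa using h1 m hm
    · exact Polynomial.coeff_eq_zero_of_natDegree_lt (by omega)
  rw [hzero, Polynomial.coe_zero, neg_zero] at hsub
  have hE0 := eq_zero_of_clearedMahlerSeries_eq_zero hk0 a hk ha hQ hsub (by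
    refine le_trans ?_ (PowerSeries.nat_le_order _ _ (PowerSeries.X_pow_dvd_iff.1 hE))
    norm_cast
    omega)
  exact isRationalSeries_of_mul_eq hQ (sub_eq_zero.1 hE0)

/-! ### Degrees of constant coefficients of minimal polynomials -/

section Minpoly

variable {K Λ : Type*} [Field K] [Field Λ] [Algebra K Λ]

theorem natDegree_minpoly_le_finrank_of_mem (L : IntermediateField K Λ) [FiniteDimensional K L]
    {x : Λ} (hx : x ∈ L) : (minpoly K x).natDegree ≤ Module.finrank K L := by
  have h := minpoly.natDegree_le (A := K) (⟨x, hx⟩ : L)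
  rwa [IntermediateField.minpoly_eq] at h

theorem coeff_zero_minpoly_algebraMap_mul {s : K} (hs : s ≠ 0) {x : Λ} (hx : IsIntegral K x) :
    (minpoly K (algebraMap K Λ s * x)).coeff 0 =
      s ^ (minpoly K x).natDegree * (minpoly K x).coeff 0 := by
  rw [← Algebra.smul_def, IsIntegrallyClosed.minpoly_smul hs hx, Polynomial.coeff_scaleRoots,
    Nat.sub_zero, mul_comm]

/-- If `x` is a root of a monic polynomial over a subring `A` whose coefficient of index `l` has
valuation at most `v(s)⁻¹ ^ (n - l)`, then `s x` is integral over the valuation ring. -/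
theorem isIntegral_valuationSubring_mul {A Γ₀ : Type*} [CommRing A] [Algebra A K] [Algebra A Λ]
    [IsScalarTower A K Λ] [LinearOrderedCommGroupWithZero Γ₀] (v : Valuation K Γ₀) (s : K)
    {x : Λ} {P : A[X]} (hP : P.Monic) (hx : Polynomial.aeval x P = 0)
    (hv : ∀ l < P.natDegree, v (algebraMap A K (P.coeff l)) * v s ^ (P.natDegree - l) ≤ 1) :
    IsIntegral v.valuationSubring (algebraMap K Λ s * x) := by
  set Q : K[X] := (P.map (algebraMap A K)).scaleRoots s with hQ
  have hPm := hP.map (algebraMap A K)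
  have hQm : Q.Monic := (Polynomial.monic_scaleRoots_iff s).2 hPm
  have hQx : Polynomial.aeval (algebraMap K Λ s * x) Q = 0 :=
    Polynomial.scaleRoots_aeval_eq_zero (by rwa [Polynomial.aeval_map_algebraMap])
  have hlift : Q ∈ Polynomial.lifts (algebraMap v.valuationSubring K) := by
    rw [Polynomial.lifts_iff_coeff_lifts]
    intro l
    refine ⟨⟨Q.coeff l, ?_⟩, rfl⟩
    rw [Valuation.mem_valuationSubring_iff, hQ, Polynomial.coeff_scaleRoots, map_mul, map_pow,
      hP.natDegree_map, Polynomial.coeff_map]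
    obtain hl | hl | hl := lt_trichotomy l P.natDegree
    · exact hv l hl
    · subst hl
      simp [hP.coeff_natDegree]
    · simp [Polynomial.coeff_eq_zero_of_natDegree_lt hl]
  obtain ⟨R, hR, -, hRm⟩ := Polynomial.lifts_and_natDegree_eq_and_monic hlift hQm
  refine ⟨R, hRm, ?_⟩
  rw [← hR] at hQx
  rwa [Polynomial.aeval_map_algebraMap] at hQx

/-- Let `U` be a nonzero combination, with coefficients that are integral over `A` and at `v`, of
elements `y i` of a finite extension `L` that are integral over `A` with controlled poles at `v`.
The constant coefficient of its minimal polynomial is a nonzero multiple of `U` in `A` whose pole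
at `v` is bounded in terms of `s` and `[L : K]` only. -/
theorem exists_multiple_with_bounded_valuation {A Γ₀ ι : Type*} [CommRing A] [IsDomain A]
    [IsIntegrallyClosed A] [Algebra A K] [IsFractionRing A K] [Algebra A Λ] [IsScalarTower A K Λ]
    [LinearOrderedCommGroupWithZero Γ₀] (v : Valuation K Γ₀) {s : K} (hs : s ≠ 0)
    (t : Finset ι) (c : ι → A) (hc : ∀ i ∈ t, v (algebraMap A K (c i)) ≤ 1)
    (y : ι → Λ) (P : ι → A[X]) (hP : ∀ i ∈ t, (P i).Monic)
    (hy : ∀ i ∈ t, Polynomial.aeval (y i) (P i) = 0)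
    (hv : ∀ i ∈ t, ∀ l < (P i).natDegree,
      v (algebraMap A K ((P i).coeff l)) * v s ^ ((P i).natDegree - l) ≤ 1)
    (L : IntermediateField K Λ) [FiniteDimensional K L] (hL : ∀ i ∈ t, y i ∈ L)
    (hU : ∑ i ∈ t, algebraMap A Λ (c i) * y i ≠ 0) :
    ∃ p : A, p ≠ 0 ∧ (∃ z : Λ, IsIntegral A z ∧
      (∑ i ∈ t, algebraMap A Λ (c i) * y i) * z = algebraMap A Λ p) ∧
      ∃ n ≤ Module.finrank K L, v s ^ n * v (algebraMap A K p) ≤ 1 := by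
  set U := ∑ i ∈ t, algebraMap A Λ (c i) * y i with hUdef
  have hUint : IsIntegral A U :=
    IsIntegral.sum _ fun i hi => isIntegral_algebraMap.mul ⟨P i, hP i hi, hy i hi⟩
  have hUK : IsIntegral K U := hUint.tower_top
  have hUL : U ∈ L := sum_mem fun i hi => mul_mem
    (by rw [IsScalarTower.algebraMap_apply A K Λ]; exact L.algebraMap_mem _) (hL i hi)
  have hUv : IsIntegral v.valuationSubring (algebraMap K Λ s * U) := by
    rw [hUdef, Finset.mul_sum]
    refine IsIntegral.sum _ fun i hi => ?_
    rw [mul_left_comm]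
    refine IsIntegral.mul ?_ (isIntegral_valuationSubring_mul v s (hP i hi) (hy i hi) (hv i hi))
    rw [IsScalarTower.algebraMap_apply A K Λ]
    exact isIntegral_algebraMap (R := v.valuationSubring) (A := Λ)
      (x := ⟨algebraMap A K (c i), hc i hi⟩)
  have hmin := minpoly.isIntegrallyClosed_eq_field_fractions' K hUint
  have hminv := minpoly.isIntegrallyClosed_eq_field_fractions' K hUv
  have hcoeff : algebraMap A K ((minpoly A U).coeff 0) = (minpoly K U).coeff 0 := by
    rw [hmin, Polynomial.coeff_map]
  refine ⟨(minpoly A U).coeff 0, fun h0 => ?_, ?_, ?_⟩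
  · rw [h0, map_zero] at hcoeff
    exact minpoly.coeff_zero_ne_zero hUK hU hcoeff.symm
  · -- the cofactor of `U` is read off from the minimal equation of `U`
    refine ⟨-Polynomial.aeval U (minpoly A U).divX, ?_, ?_⟩
    · exact IsIntegral.neg (adjoin_le_integralClosure hUint
        (Polynomial.aeval_mem_adjoin_singleton A U))
    · have h := minpoly.aeval A U
      rw [← Polynomial.divX_mul_X_add (minpoly A U), map_add, map_mul, Polynomial.aeval_X,
        Polynomial.aeval_C] at h
      linear_combination -h
  · refine ⟨(minpoly K U).natDegree, natDegree_minpoly_le_finrank_of_mem L hUL, ?_⟩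
    rw [hcoeff, ← map_pow, ← map_mul, ← coeff_zero_minpoly_algebraMap_mul hs hUK, hminv,
      Polynomial.coeff_map]
    exact ((minpoly v.valuationSubring (algebraMap K Λ s * U)).coeff 0).2

end Minpoly

/-! ### Rotations `z ↦ ζ z` by roots of unity -/

theorem rescale_coe (ζ : ℂ) (p : ℂ[X]) :
    PowerSeries.rescale ζ (p : ℂ⟦X⟧) =
      (Polynomial.compRingHom (Polynomial.C ζ * Polynomial.X) p : ℂ[X]) := by
  ext n
  rw [PowerSeries.coeff_rescale, Polynomial.coeff_coe, Polynomial.coeff_coe,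
    Polynomial.coe_compRingHom_apply, Polynomial.comp_C_mul_X_coeff, mul_comm]

theorem aeval_rescale (ζ : ℂ) (y : ℂ⟦X⟧) (P : ℂ[X][X]) :
    Polynomial.aeval (PowerSeries.rescale ζ y)
      (P.map (Polynomial.compRingHom (Polynomial.C ζ * Polynomial.X))) =
        PowerSeries.rescale ζ (Polynomial.aeval y P) := by
  refine (Polynomial.map_aeval_eq_aeval_map (RingHom.ext fun p => ?_) P y).symm
  exact (rescale_coe ζ p).symm

theorem natDegree_compRingHom_C_mul_X_le (ζ : ℂ) (p : ℂ[X]) :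
    (Polynomial.compRingHom (Polynomial.C ζ * Polynomial.X) p).natDegree ≤ p.natDegree := by
  rw [Polynomial.coe_compRingHom_apply, Polynomial.natDegree_comp]
  exact (Nat.mul_le_mul_left _
    ((Polynomial.natDegree_C_mul_le ζ _).trans Polynomial.natDegree_X_le)).trans_eq (mul_one _)

/-- Summing over the rotations by `q`-th roots of unity isolates, up to the factor `q`, the
coefficients of index congruent to `j` modulo `q`; only the indices up to `j` are recorded. -/
theorem coeff_sum_rescale {q j m : ℕ} {ζ : ℂ} (hζ : IsPrimitiveRoot ζ q) (hj : j < q) (hm : m ≤ j)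
    (y : ℂ⟦X⟧) :
    PowerSeries.coeff m (∑ i ∈ Finset.range q,
      ((Polynomial.C ((ζ ^ i) ^ j)⁻¹ : ℂ[X]) : ℂ⟦X⟧) * PowerSeries.rescale (ζ ^ i) y) =
        if m = j then q * PowerSeries.coeff j y else 0 := by
  have hζ0 : ζ ≠ 0 := hζ.ne_zero (by omega)
  have h : PowerSeries.coeff m (∑ i ∈ Finset.range q,
      ((Polynomial.C ((ζ ^ i) ^ j)⁻¹ : ℂ[X]) : ℂ⟦X⟧) * PowerSeries.rescale (ζ ^ i) y) =
      (∑ i ∈ Finset.range q, (ζ ^ m * (ζ ^ j)⁻¹) ^ i) * PowerSeries.coeff m y := by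
    rw [map_sum, Finset.sum_mul]
    refine Finset.sum_congr rfl fun i _ => ?_
    rw [Polynomial.coe_C, PowerSeries.coeff_C_mul, PowerSeries.coeff_rescale, mul_pow, inv_pow,
      ← pow_mul, ← pow_mul, ← pow_mul, ← pow_mul, mul_comm i, mul_comm i]
    ring
  rw [h]
  split_ifs with hmj
  · subst hmj
    simp [mul_inv_cancel₀ (pow_ne_zero m hζ0)]
  · have hne : ζ ^ m * (ζ ^ j)⁻¹ ≠ 1 := fun h1 =>
      hmj (hζ.pow_inj (by omega) hj ((mul_inv_eq_one₀ (pow_ne_zero j hζ0)).1 h1))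
    rw [geom_sum_eq hne, mul_pow, inv_pow, ← pow_mul, ← pow_mul, mul_comm m, mul_comm j, pow_mul,
      pow_mul, hζ.pow_eq_one]
    simp

section Rotation

open scoped WithZero

variable {K Λ : Type*} [Field K] [Field Λ] [Algebra ℂ[X] K] [IsFractionRing ℂ[X] K]
  [Algebra ℂ⟦X⟧ Λ] [IsFractionRing ℂ⟦X⟧ Λ] [Algebra ℂ[X] Λ] [IsScalarTower ℂ[X] ℂ⟦X⟧ Λ]
  [Algebra K Λ] [IsScalarTower ℂ[X] K Λ]

/-- A power series that is integral over `ℂ[z]` and all of whose rotations by roots of unity of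
order `k ^ n` lie in one finite extension `L` of `ℂ(z)` is a polynomial.

The part `u` of `y` supported in the residue class of `j` modulo `k ^ n` is a combination of
rotations of `y`. It is divisible by `z ^ j`, and it divides the constant coefficient of its
minimal polynomial, whose degree is bounded independently of `j` and `n`. Hence `u = 0` for
large `j`. -/
theorem exists_coe_eq_of_isIntegral_of_rescale_mem (v : Valuation K ℤᵐ⁰)
    (hv : ∀ p : ℂ[X], p ≠ 0 → v (algebraMap ℂ[X] K p) = WithZero.exp (p.natDegree : ℤ))
    {k : ℕ} (hk : 2 ≤ k) {y : ℂ⟦X⟧} (hy : IsIntegral ℂ[X] y)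
    (L : IntermediateField K Λ) [FiniteDimensional K L]
    (hL : ∀ (n : ℕ) (ζ : ℂ), ζ ^ k ^ n = 1 →
      algebraMap ℂ⟦X⟧ Λ (PowerSeries.rescale ζ y) ∈ L) :
    ∃ p : ℂ[X], (p : ℂ⟦X⟧) = y := by
  obtain ⟨P, hP, hPy⟩ := hy
  -- `y / z ^ A` is integral at infinity, because the coefficient of index `l` of the monic `P` has
  -- degree at most `A ≤ A * (deg P - l)`
  set A : ℕ := (Finset.range P.natDegree).sup fun l => (P.coeff l).natDegree with hA
  set s : K := (algebraMap ℂ[X] K (Polynomial.X ^ A))⁻¹ with hs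
  have hXA : algebraMap ℂ[X] K (Polynomial.X ^ A) ≠ 0 := by
    simp
  have hvs : v s = WithZero.exp (-(A : ℤ)) := by
    rw [hs, map_inv₀, hv _ (pow_ne_zero _ Polynomial.X_ne_zero), Polynomial.natDegree_X_pow,
      WithZero.exp_neg]
  have hvle : ∀ p : ℂ[X], v (algebraMap ℂ[X] K p) ≤ WithZero.exp (p.natDegree : ℤ) := by
    intro p
    obtain rfl | hp := eq_or_ne p 0
    · simp
    · exact (hv p hp).le
  suffices hzero : ∀ j, A * Module.finrank K L < j → PowerSeries.coeff j y = 0 by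
    refine ⟨PowerSeries.trunc (A * Module.finrank K L + 1) y, ?_⟩
    ext j
    rw [Polynomial.coeff_coe, PowerSeries.coeff_trunc]
    split_ifs with h
    · rfl
    · exact (hzero j (by omega)).symm
  intro j hj
  by_contra hyj
  have hjq : j < k ^ j := Nat.lt_pow_self (by omega)
  -- any power `k ^ n` exceeding `j` would serve as modulus; `n = j` suffices
  set q := k ^ j with hq
  set ζ := Complex.exp (2 * Real.pi * Complex.I / q) with hζdef
  have hζ : IsPrimitiveRoot ζ q := Complex.isPrimitiveRoot_exp q (by omega)
  set u : ℂ⟦X⟧ := ∑ i ∈ Finset.range q,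
      ((Polynomial.C ((ζ ^ i) ^ j)⁻¹ : ℂ[X]) : ℂ⟦X⟧) * PowerSeries.rescale (ζ ^ i) y with hu
  have hucoeff : ∀ m ≤ j, PowerSeries.coeff m u = if m = j then q * PowerSeries.coeff j y else 0 :=
    fun m hm => coeff_sum_rescale hζ hjq hm y
  have hinj : Function.Injective (algebraMap ℂ⟦X⟧ Λ) := IsFractionRing.injective ℂ⟦X⟧ Λ
  have hu0 : u ≠ 0 := by
    intro h0
    have h1 := hucoeff j le_rfl
    rw [h0, map_zero, if_pos rfl] at h1
    have hq0 : (q : ℂ) ≠ 0 := by exact_mod_cast (show q ≠ 0 by omega)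
    exact mul_ne_zero hq0 hyj h1.symm
  have huΛ : algebraMap ℂ⟦X⟧ Λ u = ∑ i ∈ Finset.range q,
      algebraMap ℂ[X] Λ (Polynomial.C ((ζ ^ i) ^ j)⁻¹) *
        algebraMap ℂ⟦X⟧ Λ (PowerSeries.rescale (ζ ^ i) y) := by
    rw [hu, map_sum]
    refine Finset.sum_congr rfl fun i _ => ?_
    rw [map_mul, IsScalarTower.algebraMap_apply ℂ[X] ℂ⟦X⟧ Λ]
    rfl
  obtain ⟨p, hp0, ⟨z, hz, hpz⟩, n, hn, hnv⟩ := exists_multiple_with_bounded_valuation v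
    (inv_ne_zero hXA) (Finset.range q) (fun i => Polynomial.C ((ζ ^ i) ^ j)⁻¹)
    (fun i _ => (hvle _).trans_eq (by simp))
    (fun i => algebraMap ℂ⟦X⟧ Λ (PowerSeries.rescale (ζ ^ i) y))
    (fun i => P.map (Polynomial.compRingHom (Polynomial.C (ζ ^ i) * Polynomial.X)))
    (fun i _ => hP.map _)
    (fun i _ => by
      rw [Polynomial.aeval_algebraMap_apply, aeval_rescale, Polynomial.aeval_def, hPy, map_zero,
        map_zero])
    (fun i _ l hl => by
      rw [hP.natDegree_map] at hl ⊢
      rw [← hs, hvs, Polynomial.coeff_map]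
      refine (mul_le_mul_left (hvle _) _).trans ?_
      rw [← WithZero.exp_nsmul, ← WithZero.exp_add, ← WithZero.exp_zero, WithZero.exp_le_exp,
        nsmul_eq_mul]
      have h1 := natDegree_compRingHom_C_mul_X_le (ζ ^ i) (P.coeff l)
      have h2 : (P.coeff l).natDegree ≤ A :=
        Finset.le_sup (f := fun l => (P.coeff l).natDegree) (Finset.mem_range.2 hl)
      have h3 : 1 ≤ P.natDegree - l := by omega
      have h4 : (P.coeff l).natDegree ≤ (P.natDegree - l) * A := by nlinarith
      have h5 := h1.trans h4
      zify at h5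
      linarith)
    L
    (fun i _ => hL j (ζ ^ i) (by rw [← hq, ← pow_mul, mul_comm, pow_mul, hζ.pow_eq_one, one_pow]))
    (by rw [← huΛ]; exact (map_ne_zero_iff _ hinj).2 hu0)
  rw [← huΛ] at hpz
  obtain ⟨w, rfl⟩ := IsIntegrallyClosed.isIntegral_iff.1 (hz.tower_top (A := ℂ⟦X⟧))
  rw [← map_mul, IsScalarTower.algebraMap_apply ℂ[X] ℂ⟦X⟧ Λ] at hpz
  have huw : u * w = (p : ℂ⟦X⟧) := hinj hpz
  have hXu : (PowerSeries.X : ℂ⟦X⟧) ^ j ∣ u := PowerSeries.X_pow_dvd_iff.2 fun m hm => by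
    rw [hucoeff m hm.le, if_neg hm.ne]
  have hXp : (PowerSeries.X : ℂ⟦X⟧) ^ j ∣ p := huw ▸ hXu.mul_right w
  have hjp : j ≤ p.natDegree := by
    by_contra hlt
    have h1 := PowerSeries.X_pow_dvd_iff.1 hXp p.natDegree (not_le.1 hlt)
    rw [Polynomial.coeff_coe] at h1
    exact hp0 (Polynomial.leadingCoeff_eq_zero.1 h1)
  rw [← hs, hvs, hv p hp0, ← WithZero.exp_nsmul, ← WithZero.exp_add, ← WithZero.exp_zero,
    WithZero.exp_le_exp, nsmul_eq_mul] at hnv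
  have h6 : p.natDegree ≤ n * A := by
    zify
    linarith
  have h7 := Nat.mul_le_mul_left A hn
  nlinarith

end Rotation

/-! ### Mahler equations with nonzero lowest coefficient -/

/-- The section `∑ gᵢ z ^ i ↦ ∑ g_{q i} z ^ i` is linear over the power series in
`z ^ q`, which it identifies with power series in `z`. -/
theorem mk_coeff_mul_expand {q : ℕ} (hq : q ≠ 0) (G H : ℂ⟦X⟧) :
    (PowerSeries.mk fun n => PowerSeries.coeff (q * n) (G * PowerSeries.expand q hq H)) =
      (PowerSeries.mk fun n => PowerSeries.coeff (q * n) G) * H := by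
  ext n
  rw [PowerSeries.coeff_mk, PowerSeries.coeff_mul, PowerSeries.coeff_mul]
  symm
  have hq' : 0 < q := Nat.pos_of_ne_zero hq
  refine Finset.sum_of_injOn (fun x : ℕ × ℕ => (q * x.1, q * x.2)) ?_ ?_ ?_ ?_
  · rintro ⟨a, b⟩ _ ⟨c, e⟩ _ h
    simp only [Prod.mk.injEq, Nat.mul_right_inj hq] at h ⊢
    exact h
  · rintro ⟨a, b⟩ h
    have hab : a + b = n := Finset.HasAntidiagonal.mem_antidiagonal.1 h
    rw [Finset.mem_coe, Finset.HasAntidiagonal.mem_antidiagonal, ← hab, mul_add]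
  · rintro ⟨a, b⟩ h hne
    have hab : a + b = q * n := Finset.HasAntidiagonal.mem_antidiagonal.1 h
    rw [PowerSeries.coeff_expand_of_not_dvd, mul_zero]
    rintro ⟨c, rfl⟩
    obtain ⟨e, rfl⟩ : q ∣ a := (Nat.dvd_add_left (dvd_mul_right q c)).1 (hab ▸ dvd_mul_right q n)
    refine hne ⟨(e, c), ?_, rfl⟩
    rw [← mul_add, Nat.mul_right_inj hq] at hab
    simpa using hab
  · rintro ⟨a, b⟩ _
    simp [PowerSeries.coeff_expand_mul]

theorem coe_contract {q : ℕ} (hq : q ≠ 0) (p : ℂ[X]) :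
    ((Polynomial.contract q p : ℂ[X]) : ℂ⟦X⟧) =
      PowerSeries.mk fun n => PowerSeries.coeff (q * n) (p : ℂ⟦X⟧) := by
  ext n
  rw [Polynomial.coeff_coe, Polynomial.coeff_contract hq, PowerSeries.coeff_mk,
    Polynomial.coeff_coe, mul_comm]

section Iterate

variable {k : ℕ} (hk : k ≠ 0)

/-- The iterate `F(z ^ (k ^ i))`. -/
noncomputable def mahlerIterate (F : ℂ⟦X⟧) (i : ℕ) : ℂ⟦X⟧ :=
  PowerSeries.expand (k ^ i) (pow_ne_zero _ hk) F

theorem expand_mahlerIterate (F : ℂ⟦X⟧) (n i : ℕ) :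
    PowerSeries.expand (k ^ n) (pow_ne_zero _ hk) (mahlerIterate hk F i) =
      mahlerIterate hk F (n + i) := by
  rw [mahlerIterate, mahlerIterate, ← PowerSeries.expand_mul]
  simp only [pow_add]

theorem mahlerIterate_zero (F : ℂ⟦X⟧) : mahlerIterate hk F 0 = F := by
  simp only [mahlerIterate, pow_zero, PowerSeries.expand_one_apply]

theorem rescale_mahlerIterate {ζ : ℂ} {n i : ℕ} (hni : n ≤ i) (hζ : ζ ^ k ^ n = 1) (F : ℂ⟦X⟧) :
    PowerSeries.rescale ζ (mahlerIterate hk F i) = mahlerIterate hk F i := by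
  ext m
  rw [PowerSeries.coeff_rescale, mahlerIterate]
  by_cases hm : k ^ i ∣ m
  · obtain ⟨c, rfl⟩ := (pow_dvd_pow k hni).trans hm
    rw [pow_mul, hζ, one_pow, one_mul]
  · rw [PowerSeries.coeff_expand_of_not_dvd _ _ _ hm, mul_zero]

theorem SatisfiesMahlerEquation.sum_range {d : ℕ} {a : Fin (d + 1) → ℂ[X]} {F : ℂ⟦X⟧}
    (hF : SatisfiesMahlerEquation k d a F) :
    ∃ a' : ℕ → ℂ[X], (∀ i : Fin (d + 1), a' i = a i) ∧
      ∑ i ∈ Finset.range (d + 1), (a' i : ℂ⟦X⟧) * mahlerIterate hk F i = 0 := by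
  refine ⟨fun i => if h : i < d + 1 then a ⟨i, h⟩ else 0, fun i => dif_pos i.2, ?_⟩
  rw [← Fin.sum_univ_eq_sum_range (fun i =>
    ((if h : i < d + 1 then a ⟨i, h⟩ else 0 : ℂ[X]) : ℂ⟦X⟧) * mahlerIterate hk F i)]
  refine Eq.trans (Finset.sum_congr rfl fun i _ => ?_) hF
  rw [substPow_eq_expand (pow_ne_zero _ hk), mahlerIterate, dif_pos i.2]

/-- A nontrivial Mahler equation may be assumed to have a nonzero coefficient of lowest index:
after multiplication by a suitable power of `z`, a section `∑ gᵢ z ^ i ↦ ∑ g_{k ^ s i} z ^ i`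
lowers all indices by `s`. -/
theorem exists_mahlerEquation_zero_ne_zero {d : ℕ} {a : ℕ → ℂ[X]} (ha : a d ≠ 0) {F : ℂ⟦X⟧}
    (hF : ∑ i ∈ Finset.range (d + 1), (a i : ℂ⟦X⟧) * mahlerIterate hk F i = 0) :
    ∃ (e : ℕ) (b : ℕ → ℂ[X]), b 0 ≠ 0 ∧
      ∑ i ∈ Finset.range (e + 1), (b i : ℂ⟦X⟧) * mahlerIterate hk F i = 0 := by
  classical
  have hex : ∃ s, a s ≠ 0 := ⟨d, ha⟩
  set s := Nat.find hex with hs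
  have has : a s ≠ 0 := Nat.find_spec hex
  have hsd : s ≤ d := Nat.find_min' hex ha
  have hq : k ^ s ≠ 0 := pow_ne_zero _ hk
  obtain ⟨m, hm⟩ : ∃ m, (a s).coeff m ≠ 0 := by
    by_contra! h
    exact has (Polynomial.ext h)
  -- multiplication by `z ^ t` moves the nonzero coefficient of index `m` to index `k ^ s * m`
  set t := k ^ s * m - m with ht
  have htm : k ^ s * m = m + t := by
    have := Nat.le_mul_of_pos_left m (Nat.pos_of_ne_zero hq)
    omega
  refine ⟨d - s, fun i => Polynomial.contract (k ^ s) (a (s + i) * Polynomial.X ^ t), ?_, ?_⟩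
  · intro h0
    have h1 := congrArg (fun p => Polynomial.coeff p m) h0
    simp only [add_zero, Polynomial.coeff_contract hq, mul_comm m, htm, Polynomial.coeff_mul_X_pow,
      Polynomial.coeff_zero] at h1
    exact hm h1
  · have hF' : ∑ i ∈ Finset.range (d - s + 1),
        (a (s + i) : ℂ⟦X⟧) * mahlerIterate hk F (s + i) = 0 := by
      rw [show d + 1 = s + (d - s + 1) by omega, Finset.sum_range_add, Finset.sum_eq_zero, zero_add]
        at hF
      · exact hF
      · intro i hi
        rw [not_not.1 (Nat.find_min hex (Finset.mem_range.1 hi)), Polynomial.coe_zero, zero_mul]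
    have h2 := congrArg (fun G : ℂ⟦X⟧ =>
      PowerSeries.mk fun n => PowerSeries.coeff (k ^ s * n) (PowerSeries.X ^ t * G)) hF'
    simp only [Finset.mul_sum, map_sum, mul_zero, map_zero] at h2
    ext n
    have h3 := congrArg (PowerSeries.coeff n) h2
    rw [PowerSeries.coeff_mk, PowerSeries.coeff_mk] at h3
    rw [map_sum, map_zero, ← h3]
    refine Finset.sum_congr rfl fun i _ => ?_
    rw [coe_contract hq, ← mk_coeff_mul_expand hq, expand_mahlerIterate, PowerSeries.coeff_mk,
      Polynomial.coe_mul, Polynomial.coe_pow, Polynomial.coe_X]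
    congr 1
    ring

/-- If the coefficient of lowest index is nonzero, then `F` is, up to a polynomial factor, a
combination of the iterates `F(z ^ (k ^ i))` with `i ≥ n`. -/
theorem exists_smul_mem_span_mahlerIterate {e : ℕ} {b : ℕ → ℂ[X]} (hb : b 0 ≠ 0) {F : ℂ⟦X⟧}
    (hF : ∑ i ∈ Finset.range (e + 1), (b i : ℂ⟦X⟧) * mahlerIterate hk F i = 0) (n : ℕ) :
    ∃ D : ℂ[X], D ≠ 0 ∧ D • F ∈ Submodule.span ℂ[X] (mahlerIterate hk F '' Set.Ici n) := by
  induction n with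
  | zero =>
    refine ⟨1, one_ne_zero, ?_⟩
    rw [one_smul]
    exact Submodule.subset_span ⟨0, Set.mem_Ici.2 le_rfl, mahlerIterate_zero hk F⟩
  | succ n ih =>
    obtain ⟨D, hD, hDF⟩ := ih
    -- the equation at `z ^ (k ^ n)` expresses `c * F(z ^ (k ^ n))` by iterates of higher index
    set c : ℂ[X] := Polynomial.expand ℂ (k ^ n) (b 0) with hc
    refine ⟨c * D, mul_ne_zero
      ((Polynomial.expand_ne_zero (Nat.pos_of_ne_zero (pow_ne_zero _ hk))).2 hb) hD, ?_⟩
    rw [mul_smul]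
    generalize D • F = x at hDF
    induction hDF using Submodule.span_induction with
    | mem x hx =>
      obtain ⟨i, hi, rfl⟩ := hx
      obtain rfl | hlt := (Set.mem_Ici.1 hi).eq_or_lt
      · have h1 := congrArg (PowerSeries.expand (k ^ n) (pow_ne_zero _ hk)) hF
        rw [Finset.sum_range_succ', map_add, map_zero, map_mul, expand_mahlerIterate,
          ← coe_expand, add_zero, ← hc, map_sum] at h1
        rw [Algebra.smul_def]
        change (c : ℂ⟦X⟧) * _ ∈ _
        rw [eq_neg_of_add_eq_zero_right h1]
        refine neg_mem (sum_mem fun i _ => ?_)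
        rw [map_mul, expand_mahlerIterate, ← coe_expand]
        exact Submodule.smul_mem _ (Polynomial.expand ℂ (k ^ n) (b (i + 1)))
          (Submodule.subset_span ⟨n + (i + 1), by simp, rfl⟩)
      · exact Submodule.smul_mem _ _ (Submodule.subset_span ⟨i, hlt, rfl⟩)
    | zero => simp
    | add x y _ _ hx hy => rw [smul_add]; exact add_mem hx hy
    | smul p x _ hx => rw [smul_comm]; exact Submodule.smul_mem _ _ hx

/-! ### Algebraic solutions are rational -/

theorem algebraMap_coe_mem {K Λ : Type*} [Field K] [Field Λ] [Algebra ℂ[X] K] [Algebra ℂ⟦X⟧ Λ]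
    [Algebra ℂ[X] Λ] [IsScalarTower ℂ[X] ℂ⟦X⟧ Λ] [Algebra K Λ] [IsScalarTower ℂ[X] K Λ]
    (L : IntermediateField K Λ) (p : ℂ[X]) : algebraMap ℂ⟦X⟧ Λ (p : ℂ⟦X⟧) ∈ L := by
  have h : algebraMap ℂ⟦X⟧ Λ (p : ℂ⟦X⟧) = algebraMap K Λ (algebraMap ℂ[X] K p) := by
    rw [← IsScalarTower.algebraMap_apply ℂ[X] K Λ, IsScalarTower.algebraMap_apply ℂ[X] ℂ⟦X⟧ Λ]
    rfl
  rw [h]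
  exact L.algebraMap_mem _

section Algebraic

open scoped WithZero

variable {K Λ : Type*} [Field K] [Field Λ] [Algebra ℂ[X] K] [IsFractionRing ℂ[X] K]
  [Algebra ℂ⟦X⟧ Λ] [IsFractionRing ℂ⟦X⟧ Λ] [Algebra ℂ[X] Λ] [IsScalarTower ℂ[X] ℂ⟦X⟧ Λ]
  [Algebra K Λ] [IsScalarTower ℂ[X] K Λ]

theorem isAlgebraic_mahlerIterate {F : ℂ⟦X⟧} (hF : IsAlgebraic ℂ[X] F) (i : ℕ) :
    IsAlgebraic ℂ[X] (mahlerIterate hk F i) := by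
  obtain ⟨P, hP, hPF⟩ := hF
  have hi : 0 < k ^ i := Nat.pos_of_ne_zero (pow_ne_zero _ hk)
  refine ⟨P.map (Polynomial.expand ℂ (k ^ i)).toRingHom, ?_, ?_⟩
  · exact (Polynomial.map_ne_zero_iff (Polynomial.expand_injective hi)).2 hP
  · have h := Polynomial.map_aeval_eq_aeval_map
      (φ := (Polynomial.expand ℂ (k ^ i)).toRingHom)
      (ψ := (PowerSeries.expand (R := ℂ) (k ^ i) (pow_ne_zero _ hk)).toRingHom)
      (RingHom.ext fun p => coe_expand (pow_ne_zero i hk) p) P F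
    rw [hPF, map_zero] at h
    exact h.symm

/-- The iterates of an algebraic Mahler function generate a finite extension of `ℂ(z)`. -/
theorem exists_finiteDimensional_mahlerIterate_mem {d : ℕ} {a : ℕ → ℂ[X]} (ha : a d ≠ 0)
    {F : ℂ⟦X⟧} (hF : ∑ i ∈ Finset.range (d + 1), (a i : ℂ⟦X⟧) * mahlerIterate hk F i = 0)
    (halg : IsAlgebraic ℂ[X] F) :
    ∃ L : IntermediateField K Λ, FiniteDimensional K L ∧
      ∀ i, algebraMap ℂ⟦X⟧ Λ (mahlerIterate hk F i) ∈ L := by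
  have hinj : Function.Injective (algebraMap ℂ⟦X⟧ Λ) := IsFractionRing.injective ℂ⟦X⟧ Λ
  set S : Set Λ := (fun i => algebraMap ℂ⟦X⟧ Λ (mahlerIterate hk F i)) '' Set.Iio d with hS
  have hSfin : Finite S := (Set.finite_Iio d).image _
  refine ⟨IntermediateField.adjoin K S, IntermediateField.finiteDimensional_adjoin ?_, ?_⟩
  · rintro _ ⟨i, _, rfl⟩
    rw [← isAlgebraic_iff_isIntegral, ← IsFractionRing.isAlgebraic_iff ℂ[X] K Λ]
    exact (isAlgebraic_mahlerIterate hk halg i).algebraMap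
  · intro i
    induction i using Nat.strong_induction_on with
    | _ i ih =>
      obtain hid | hid := lt_or_ge i d
      · exact IntermediateField.subset_adjoin K S ⟨i, hid, rfl⟩
      obtain ⟨n, rfl⟩ := Nat.exists_eq_add_of_le' hid
      have hmem := algebraMap_coe_mem (IntermediateField.adjoin K S)
      have h1 := congrArg (PowerSeries.expand (k ^ n) (pow_ne_zero _ hk)) hF
      rw [Finset.sum_range_succ, map_add, map_zero, map_mul, expand_mahlerIterate,
        ← coe_expand, map_sum] at h1
      have h2 := congrArg (algebraMap ℂ⟦X⟧ Λ) (eq_neg_of_add_eq_zero_right h1)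
      have hc : algebraMap ℂ⟦X⟧ Λ ((Polynomial.expand ℂ (k ^ n) (a d) : ℂ[X]) : ℂ⟦X⟧) ≠ 0 := by
        rw [map_ne_zero_iff _ hinj, Ne, Polynomial.coe_eq_zero_iff,
          ← Ne, Polynomial.expand_ne_zero (Nat.pos_of_ne_zero (pow_ne_zero _ hk))]
        exact ha
      rw [map_mul, mul_comm, ← eq_div_iff hc] at h2
      rw [h2]
      refine div_mem ?_ (hmem _)
      rw [map_neg, map_sum]
      refine neg_mem (sum_mem fun i hi => ?_)
      rw [map_mul, expand_mahlerIterate, ← coe_expand, map_mul]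
      exact mul_mem (hmem _) (ih _ (by have := Finset.mem_range.1 hi; omega))

end Algebraic

end Iterate

open scoped WithZero in
/-- An algebraic Mahler function is a quotient of polynomials: for `ζ ^ (k ^ n) = 1` the rotation
`z ↦ ζ z` fixes the iterates of index at least `n`, which span `F` over `ℂ(z)`, so it maps `F` into
the finite extension that all iterates generate. -/
theorem exists_mul_eq_of_isAlgebraic {k : ℕ} {K : Type*} (Λ : Type*) [Field K] [Field Λ]
    [Algebra ℂ[X] K] [IsFractionRing ℂ[X] K] [Algebra ℂ⟦X⟧ Λ] [IsFractionRing ℂ⟦X⟧ Λ]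
    [Algebra ℂ[X] Λ] [IsScalarTower ℂ[X] ℂ⟦X⟧ Λ] [Algebra K Λ] [IsScalarTower ℂ[X] K Λ]
    (v : Valuation K ℤᵐ⁰)
    (hv : ∀ p : ℂ[X], p ≠ 0 → v (algebraMap ℂ[X] K p) = WithZero.exp (p.natDegree : ℤ))
    (hk2 : 2 ≤ k) {d : ℕ} {a : Fin (d + 1) → ℂ[X]} (ha : a (Fin.last d) ≠ 0) {F : ℂ⟦X⟧}
    (hF : SatisfiesMahlerEquation k d a F) (halg : IsAlgebraic ℂ[X] F) :
    ∃ P Q : ℂ[X], Q ≠ 0 ∧ (Q : ℂ⟦X⟧) * F = P := by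
  have hk : k ≠ 0 := by omega
  obtain ⟨a', ha', hF'⟩ := hF.sum_range hk
  replace ha' : a' d ≠ 0 := by
    have := ha' (Fin.last d)
    rw [Fin.val_last] at this
    rwa [this]
  obtain ⟨L, hLfin, hL⟩ := exists_finiteDimensional_mahlerIterate_mem (K := K) (Λ := Λ) hk ha' hF'
    halg
  obtain ⟨e, b, hb, hFb⟩ := exists_mahlerEquation_zero_ne_zero hk ha' hF'
  have hinj : Function.Injective (algebraMap ℂ⟦X⟧ Λ) := IsFractionRing.injective ℂ⟦X⟧ Λ
  have hpoly := algebraMap_coe_mem L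
  have hrot : ∀ (n : ℕ) (ζ : ℂ), ζ ^ k ^ n = 1 →
      algebraMap ℂ⟦X⟧ Λ (PowerSeries.rescale ζ F) ∈ L := by
    intro n ζ hζ
    obtain ⟨D, hD, hDF⟩ := exists_smul_mem_span_mahlerIterate hk hb hFb n
    have hmem : ∀ x ∈ Submodule.span ℂ[X] (mahlerIterate hk F '' Set.Ici n),
        algebraMap ℂ⟦X⟧ Λ (PowerSeries.rescale ζ x) ∈ L := by
      intro x hx
      induction hx using Submodule.span_induction with
      | mem x hx =>
        obtain ⟨i, hi, rfl⟩ := hx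
        rw [rescale_mahlerIterate hk hi hζ]
        exact hL i
      | zero => simp
      | add x y _ _ hx hy => rw [map_add, map_add]; exact add_mem hx hy
      | smul p x _ hx =>
        have h : p • x = (p : ℂ⟦X⟧) * x := Algebra.smul_def p x
        rw [h, map_mul, map_mul, rescale_coe]
        exact mul_mem (hpoly _) hx
    have h1 := hmem _ hDF
    rw [show D • F = (D : ℂ⟦X⟧) * F from Algebra.smul_def D F, map_mul, map_mul] at h1
    have hζ0 : ζ ≠ 0 := by
      rintro rfl
      rw [zero_pow (pow_ne_zero _ hk)] at hζ
      exact zero_ne_one hζ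
    have hD' : algebraMap ℂ⟦X⟧ Λ (PowerSeries.rescale ζ (D : ℂ⟦X⟧)) ≠ 0 := by
      rw [map_ne_zero_iff _ hinj, map_ne_zero_iff _ (PowerSeries.rescale_injective hζ0)]
      simpa using hD
    rw [rescale_coe] at h1 hD'
    rw [← mul_div_cancel_left₀ (algebraMap ℂ⟦X⟧ Λ (PowerSeries.rescale ζ F)) hD']
    exact div_mem h1 (hpoly _)
  obtain ⟨Q, hQ, hint⟩ := halg.exists_integral_multiple
  obtain ⟨P, hP⟩ := exists_coe_eq_of_isIntegral_of_rescale_mem v hv hk2 hint L (by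
    intro n ζ hζ
    rw [show Q • F = (Q : ℂ⟦X⟧) * F from Algebra.smul_def Q F, map_mul, map_mul, rescale_coe]
    exact mul_mem (hpoly _) (hrot n ζ hζ))
  exact ⟨P, Q, hQ, hP.symm⟩

theorem IsRationalSeries.isAlgebraic {F : ℂ⟦X⟧} (h : IsRationalSeries F) :
    IsAlgebraic (RatFunc ℂ) (F : ℂ⸨X⸩) := by
  obtain ⟨r, hr⟩ := h
  rw [← hr]
  exact isAlgebraic_algebraMap r

/-- A Mahler function is either rational or transcendental. -/
theorem isRationalSeries_of_isAlgebraic {k d : ℕ} (hk : 2 ≤ k) {a : Fin (d + 1) → ℂ[X]}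
    (ha : a (Fin.last d) ≠ 0) {F : ℂ⟦X⟧} (hF : SatisfiesMahlerEquation k d a F)
    (halg : IsAlgebraic (RatFunc ℂ) (F : ℂ⸨X⸩)) : IsRationalSeries F := by
  classical
  have htower : IsScalarTower ℂ[X] ℂ⟦X⟧ ℂ⸨X⸩ := IsScalarTower.of_algebraMap_eq' rfl
  have halg' : IsAlgebraic ℂ[X] F := by
    have h := (IsFractionRing.isAlgebraic_iff ℂ[X] (RatFunc ℂ) ℂ⸨X⸩).2 halg
    exact (isAlgebraic_algebraMap_iff (IsFractionRing.injective ℂ⟦X⟧ ℂ⸨X⸩)).1 h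
  obtain ⟨P, Q, hQ, h⟩ := exists_mul_eq_of_isAlgebraic ℂ⸨X⸩ (RatFunc.inftyValuation ℂ)
    (fun p hp => RatFunc.inftyValuation.polynomial ℂ hp) hk ha hF halg'
  exact isRationalSeries_of_mul_eq hQ h

theorem mainTheorem2 (k d : ℕ) (hk : 2 ≤ k) (hd : 1 ≤ d)
    (a : Fin (d + 1) → ℂ[X]) (ha : a (Fin.last d) ≠ 0)
    (F : ℂ⟦X⟧) (hF : SatisfiesMahlerEquation k d a F) :
    (IsRationalSeries F ↔
      (mahlerHankel k d (mahlerHeight a) F).rank ≠ 1 + mahlerKappa k d (mahlerHeight a)) ∧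
    (IsTranscendentalSeries F ↔
      (mahlerHankel k d (mahlerHeight a) F).rank = 1 + mahlerKappa k d (mahlerHeight a)) := by
  have hrat : IsRationalSeries F ↔
      (mahlerHankel k d (mahlerHeight a) F).rank ≠ 1 + mahlerKappa k d (mahlerHeight a) :=
    ⟨rank_mahlerHankel_ne_of_isRationalSeries hk hd a ha hF,
      isRationalSeries_of_rank_mahlerHankel_ne hk a ha hF⟩
  have htrans : IsTranscendentalSeries F ↔ ¬ IsRationalSeries F :=
    not_congr ⟨isRationalSeries_of_isAlgebraic hk ha hF, IsRationalSeries.isAlgebraic⟩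
  exact ⟨hrat, by rw [htrans, hrat, not_not]⟩
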